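/- \textbf{Notation.} Graphs are simple. Two vertex sets are \emph{connected} if some edge joins them. A component of a set $S$ of vertices of $G$ is a maximal (non-empty) subset of $S$ inducing a connected subgraph. $K_\kappa$ is a \emph{minor} of $G$ if there are pairwise disjoint non-empty sets $(X_\alpha)_{\alpha<\kappa}$ of vertices, each inducing a connected subgraph, any two of which are connected. A \emph{tree} is a poset $T$ in which every set $\operatorname{pred}(t)=\{s : s<t\}$ is well-ordered; the height $\mathrm{ht}(t)$ is the order type of $\operatorname{pred}(t)$. A \emph{branch} is a maximal chain, and a $\kappa$-branch is a branch of order type $\kappa$. For a graph $G=(V,E)$, identify $V$ with the cardinal $|V|$. Then $T_G$ denotes any tree, with sets $C_t, V_t\subseteq V$ for its nodes $t$, obtained by the following level-by-level construction (of Brochet and Diestel). It satisfies $s<t \iff C_t\subsetneq C_s$. \begin{itemize} \item Roots: there is exactly one root $t$ with $C_t=C$ for each component $C$ of $G$, and no other roots; $V_t=\{\min C_t\}$. \item Successors: a node $s$ has exactly one immediate successor $t$ with $C_t=C$ for each component $C$ of $C_s\setminus V_s$, and no others; $V_t=\{x_t\}$, where $x_t\in C_t$ is connected to $V_s$ and,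 among such vertices, has minimal distance, in the subgraph induced by $C_t$, to $\min C_t$. \item Limits: for a limit ordinal $\alpha$ and a branch $b$ of length $\alpha$ of the tree built below level $\alpha$, there is exactly one node $t$ with $\operatorname{pred}(t)=b$ and $C_t=C$ for each component $C$ of $\bigcap_{s\in b}C_s$, and no others; $V_t\subseteq C_t$ is a non-empty set inducing a connected subgraph, $|V_t|\le\mathrm{cf}(\alpha)$, and $\{s\in b : V_s \text{ is connected to } V_t\}$ is cofinal in $b$. \end{itemize} \textbf{Proposition.} For every graph $G$ the construction of $T_G$ can be carried out. Let $\kappa$ be an infinite regular cardinal. \begin{enumerate} \item For every graph $G$, if $K_\kappa$ is a minor of $G$, then $T_G$ has a branch of size at least $\kappa$. \item There is a graph $G$ of chromatic number $2$ (so in particular a countably chromatic one) such that $T_G$ has a $\kappa$-branch. \item There is a graph $G$ with an independent set of size $\kappa$ such that $T_G$ is isomorphic to $(\kappa,\in)$. \end{enumerate} In each item the claim about $T_G$ holds whatever choices (the identification of $V$ with $|V|$, the vertices $x_t$, the sets $V_t$ at limits) were made in the construction. -/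

import Mathlib

open Cardinal

universe u v w

/-- `X` and `Y` are connected in `G`: some edge of `G` joins a vertex of `X` to a vertex of `Y`. -/
def SetsJoined {V : Type u} (G : SimpleGraph V) (X Y : Set V) : Prop :=
  ∃ x ∈ X, ∃ y ∈ Y, G.Adj x y

/-- `H` is a minor of `G` (connected graphs are non-empty in Mathlib). -/
def IsGraphMinor {W : Type w} {V : Type v} (H : SimpleGraph W) (G : SimpleGraph V) : Prop :=
  ∃ X : W → Set V,
    (∀ i, (G.induce (X i)).Connected) ∧
    (∀ i j, i ≠ j → Disjoint (X i) (X j)) ∧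
    (∀ i j, H.Adj i j → SetsJoined G (X i) (X j))

/-- The complete graph `K_κ` on the vertex set `κ`, the set of ordinals below `κ`. -/
def completeGraphOn (κ : Cardinal.{u}) : SimpleGraph (Set.Iio κ.ord) := ⊤

/-- `C` is (the vertex set of) a component of the subgraph of `G` induced by `S`. -/
def IsComponentOf {V : Type u} (G : SimpleGraph V) (S C : Set V) : Prop :=
  Maximal (fun D : Set V => D ⊆ S ∧ (G.induce D).Connected) C

/-- A partial order is a tree if the predecessors of every element are well-ordered. -/
class IsTreeOrder (T : Type u) [PartialOrder T] : Prop where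
  wellOrdered : ∀ t : T, IsWellOrder (Set.Iio t) (· < ·)

/-- The height of a node of a tree: the order type of its set of predecessors. -/
noncomputable def treeHeight {T : Type u} [PartialOrder T] [IsTreeOrder T] (t : T) : Ordinal.{u} :=
  haveI := IsTreeOrder.wellOrdered t
  Ordinal.type (fun a b : Set.Iio t => a < b)

/-- A branch of a tree is a maximal chain. -/
def IsBranch {T : Type u} [PartialOrder T] (b : Set T) : Prop :=
  IsMaxChain (· ≤ ·) b

/-- A `κ`-branch: a branch whose order type is `κ`. -/
def IsBranchOfLength {T : Type u} [PartialOrder T] (κ : Cardinal.{u}) (b : Set T) : Prop :=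
  IsBranch b ∧ Nonempty (b ≃o Set.Iio κ.ord)

/-- A result `T_G` of carrying out the level-by-level construction of Brochet and Diestel on `G`.
All choices made on the way (the enumeration of the vertices, the vertices picked at successor
levels, the connected sets picked at limit levels) are part of the data. -/
structure PartitionTree {V : Type u} (G : SimpleGraph V) where
  /-- The nodes of the tree. -/
  Node : Type u
  [order : PartialOrder Node]
  [tree : IsTreeOrder Node]
  /-- The identification of the vertex set with the cardinal `#V`. -/
  enum : V ≃ Set.Iio (#V).ord
  /-- The set of vertices still to be treated at, or above, the node. -/
  C : Node → Set V
  /-- The set of vertices used up at the node. -/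
  part : Node → Set V
  /-- A node is above another one exactly if its set of vertices is strictly smaller. -/
  lt_iff : ∀ s t : Node, s < t ↔ C t ⊂ C s
  /-- At a root, `C t` is a component of `G`, and `part t` consists of its least vertex. -/
  root : ∀ t : Node, Set.Iio t = ∅ →
    IsComponentOf G Set.univ (C t) ∧
    ∃ x ∈ C t, part t = {x} ∧ ∀ z ∈ C t, enum x ≤ enum z
  /-- Every component of `G` belongs to exactly one root. -/
  root_unique : ∀ D : Set V, IsComponentOf G Set.univ D →
    ∃! t : Node, Set.Iio t = ∅ ∧ C t = D
  /-- At an immediate successor `t` of `s`, `C t` is a component of `C s \ part s`, and `part t`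
  consists of a vertex of `C t` connected to `part s` which, among these vertices, has the least
  distance, in the subgraph induced by `C t`, to the least vertex `y` of `C t`. -/
  succ : ∀ s t : Node, s ⋖ t →
    IsComponentOf G (C s \ part s) (C t) ∧
    ∃ x y : C t, part t = {x.1} ∧ (∀ z ∈ C t, enum y.1 ≤ enum z) ∧
      SetsJoined G (part s) {x.1} ∧
      ∀ x' : C t, SetsJoined G (part s) {x'.1} →
        (G.induce (C t)).dist x y ≤ (G.induce (C t)).dist x' y
  /-- Every component of `C s \ part s` belongs to exactly one immediate successor of `s`. -/
  succ_unique : ∀ (s : Node) (D : Set V), IsComponentOf G (C s \ part s) D →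
    ∃! t : Node, s ⋖ t ∧ C t = D
  /-- At a node `t` of limit height, `C t` is a component of the intersection of the sets `C s`
  over the predecessors `s` of `t`, and `part t` is a subset of `C t` inducing a connected
  subgraph, of size at most the cofinality of the height of `t`, and connected to `part s` for
  cofinally many predecessors `s` of `t`. -/
  limit : ∀ t : Node, Order.IsSuccLimit (treeHeight t) →
    IsComponentOf G (⋂ s ∈ Set.Iio t, C s) (C t) ∧
    part t ⊆ C t ∧ (G.induce (part t)).Connected ∧ #(part t) ≤ (treeHeight t).cof ∧
    ∀ s < t, ∃ s' < t, s ≤ s' ∧ SetsJoined G (part s') (part t)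
  /-- Given a branch of limit length of the tree below that limit level, i.e. a non-empty downward
  closed chain `b` without a greatest element, every component of the intersection of the sets
  `C s` over `s ∈ b` belongs to exactly one node whose set of predecessors is `b`. -/
  limit_unique : ∀ b : Set Node, IsChain (· ≤ ·) b → IsLowerSet b → b.Nonempty →
    (∀ s ∈ b, ∃ s' ∈ b, s < s') →
    ∀ D : Set V, IsComponentOf G (⋂ s ∈ b, C s) D →
      ∃! t : Node, Set.Iio t = b ∧ C t = D

attribute [instance] PartitionTree.order PartitionTree.tree

/-! For the minor, each branch set `X i` has a node `t` with `X i ⊆ C t` at which `part t` first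
meets `X i`. Nodes that are incomparable have disjoint, unjoined sets `C`, so the nodes obtained
from pairwise joined branch sets form a chain. If this chain has fewer than `κ` elements, regularity
puts `κ` of the disjoint branch sets at a single node `t`, so `part t` has size at least `κ`. Then
`t` is a limit node, and the bound by the cofinality gives it at least `κ` predecessors, again a
chain.

Both examples are the complete bipartite graph with two sides of size `κ`. Deleting fewer than `κ`
vertices leaves it connected, so the tree cannot fork or stop while fewer than `κ` vertices are used
up. It also cannot go beyond height `κ`: two consecutive successor steps suffice to use up the least
remaining vertex, and a vertex has fewer than `κ` vertices before it in the enumeration. Hence the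
tree is a copy of `κ` (`PartitionTree.mk_Iio_lt`, `PartitionTree.C_eq_compl`,
`PartitionTree.le_mk_node`).

For existence, the recursion runs along the ordinals separately for each vertex `v`, following the
component that contains `v`. The chosen part depends only on that component and its history, so
vertices in a common component have a common history, and the pairs that occur fit together to a
tree. The main point is that the set of a new node is joined to cofinally many earlier parts
(`BrochetDiestel.exists_setsJoined_level`). -/

section Components

/-! ### Components of vertex sets. -/

variable {V : Type u} {G : SimpleGraph V} {S C D E : Set V}

theorem SetsJoined.symm {X Y : Set V} (h : SetsJoined G X Y) : SetsJoined G Y X := by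
  obtain ⟨x, hx, y, hy, h⟩ := h
  exact ⟨y, hy, x, hx, h.symm⟩

theorem SetsJoined.mono {X Y X' Y' : Set V} (h : SetsJoined G X Y) (hX : X ⊆ X') (hY : Y ⊆ Y') :
    SetsJoined G X' Y' := by
  obtain ⟨x, hx, y, hy, h⟩ := h
  exact ⟨x, hX hx, y, hY hy, h⟩

theorem connected_induce_singleton (G : SimpleGraph V) (v : V) :
    (G.induce ({v} : Set V)).Connected :=
  have : Subsingleton ({v} : Set V) := Set.subsingleton_coe _ |>.2 Set.subsingleton_singleton
  have : Nonempty ({v} : Set V) := ⟨⟨v, rfl⟩⟩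
  SimpleGraph.Connected.of_subsingleton

theorem nonempty_of_connected_induce (h : (G.induce C).Connected) : C.Nonempty :=
  Set.nonempty_coe_sort.1 h.nonempty

theorem connected_induce_union (hC : (G.induce C).Connected) (hD : (G.induce D).Connected)
    (h : (C ∩ D).Nonempty ∨ SetsJoined G C D) : (G.induce (C ∪ D)).Connected := by
  rcases h with h | ⟨x, hx, y, hy, h⟩
  · exact SimpleGraph.induce_union_connected hC.preconnected hD.preconnected h
  · exact SimpleGraph.connected_induce_union hC.preconnected hD.preconnected hx hy h

/-- A connected set with a proper non-empty part has an edge leaving that part. -/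
theorem exists_adj_of_connected_induce (hC : (G.induce C).Connected) {A : Set V}
    (hA : (C ∩ A).Nonempty) (hA' : (C \ A).Nonempty) :
    ∃ x ∈ C ∩ A, ∃ y ∈ C \ A, G.Adj x y := by
  obtain ⟨a, haC, ha⟩ := hA
  obtain ⟨b, hbC, hb⟩ := hA'
  obtain ⟨p⟩ := hC.preconnected ⟨a, haC⟩ ⟨b, hbC⟩
  obtain ⟨d, -, h1, h2⟩ := p.exists_boundary_dart {x | x.1 ∈ A} ha hb
  exact ⟨d.fst.1, ⟨d.fst.2, h1⟩, d.snd.1, ⟨d.snd.2, h2⟩, d.adj⟩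

theorem IsComponentOf.subset (h : IsComponentOf G S C) : C ⊆ S := h.1.1

theorem IsComponentOf.connected (h : IsComponentOf G S C) : (G.induce C).Connected := h.1.2

theorem IsComponentOf.nonempty (h : IsComponentOf G S C) : C.Nonempty :=
  nonempty_of_connected_induce h.connected

theorem IsComponentOf.subset_of_touches (h : IsComponentOf G S C) (hD : D ⊆ S)
    (hDc : (G.induce D).Connected) (hCD : (C ∩ D).Nonempty ∨ SetsJoined G C D) : D ⊆ C :=
  Set.subset_union_right.trans
    (h.2 ⟨Set.union_subset h.subset hD, connected_induce_union h.connected hDc hCD⟩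
      Set.subset_union_left)

theorem IsComponentOf.eq_of_touches (h : IsComponentOf G S C) (h' : IsComponentOf G S D)
    (hCD : (C ∩ D).Nonempty ∨ SetsJoined G C D) : C = D := by
  refine subset_antisymm (h'.subset_of_touches h.subset h.connected ?_)
    (h.subset_of_touches h'.subset h'.connected hCD)
  rw [Set.inter_comm]
  exact hCD.imp_right SetsJoined.symm

theorem IsComponentOf.eq_of_connected (h : IsComponentOf G S C) (hS : (G.induce S).Connected) :
    C = S :=
  subset_antisymm h.subset (h.2 ⟨subset_rfl, hS⟩ h.subset)

/-- The component of `S` that contains `v`; it is empty if `v` is not in `S`. -/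
def componentAt (G : SimpleGraph V) (S : Set V) (v : V) : Set V :=
  ⋃₀ {E | E ⊆ S ∧ v ∈ E ∧ (G.induce E).Connected}

theorem componentAt_subset (G : SimpleGraph V) (S : Set V) (v : V) : componentAt G S v ⊆ S :=
  Set.sUnion_subset fun _ hE => hE.1

theorem subset_componentAt {v : V} (hE : E ⊆ S) (hv : v ∈ E) (hc : (G.induce E).Connected) :
    E ⊆ componentAt G S v :=
  Set.subset_sUnion_of_mem ⟨hE, hv, hc⟩

theorem mem_componentAt {v : V} (hv : v ∈ S) : v ∈ componentAt G S v :=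
  subset_componentAt (Set.singleton_subset_iff.2 hv) rfl (connected_induce_singleton G v) rfl

theorem mem_componentAt_iff {v : V} : v ∈ componentAt G S v ↔ v ∈ S :=
  ⟨fun h => componentAt_subset G S v h, mem_componentAt⟩

theorem isComponentOf_componentAt {v : V} (hv : v ∈ S) :
    IsComponentOf G S (componentAt G S v) := by
  refine ⟨⟨componentAt_subset G S v, ?_⟩, fun E hE h =>
    subset_componentAt hE.1 (h (mem_componentAt hv)) hE.2⟩
  exact SimpleGraph.induce_sUnion_connected_of_pairwise_not_disjoint
    ⟨{v}, Set.singleton_subset_iff.2 hv, rfl, connected_induce_singleton G v⟩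
    (fun hs ht => ⟨v, hs.2.1, ht.2.1⟩) (fun hs => hs.2.2)

theorem IsComponentOf.eq_componentAt {v : V} (h : IsComponentOf G S C) (hv : v ∈ C) :
    C = componentAt G S v :=
  h.eq_of_touches (isComponentOf_componentAt (h.subset hv))
    (Or.inl ⟨v, hv, mem_componentAt (h.subset hv)⟩)

theorem exists_isComponentOf (hD : D ⊆ S) (hc : (G.induce D).Connected) :
    ∃ C, IsComponentOf G S C ∧ D ⊆ C := by
  obtain ⟨v, hv⟩ := nonempty_of_connected_induce hc
  exact ⟨_, isComponentOf_componentAt (hD hv), subset_componentAt hD hv hc⟩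

end Components

/-! ### Order theory of trees. -/

namespace IsTreeOrder

variable {T : Type u} [PartialOrder T] [IsTreeOrder T] {r s t : T}

theorem exists_isLeast {S : Set T} (hS : S.Nonempty) (hSt : S ⊆ Set.Iic t) :
    ∃ m, IsLeast S m := by
  by_cases h : (S ∩ Set.Iio t).Nonempty
  · have := IsTreeOrder.wellOrdered t
    obtain ⟨x, hxS, hxt⟩ := h
    have hwf : WellFounded ((· < ·) : Set.Iio t → Set.Iio t → Prop) := IsWellFounded.wf
    obtain ⟨m, hm, hmin⟩ := hwf.has_min {y : Set.Iio t | y.1 ∈ S} ⟨⟨x, hxt⟩, hxS⟩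
    refine ⟨m.1, hm, fun y hy => ?_⟩
    rcases (hSt hy : y ≤ t).eq_or_lt with rfl | hyt
    · exact m.2.le
    · rcases trichotomous_of (· < ·) m ⟨y, hyt⟩ with h | h | h
      · exact (show m.1 < y from h).le
      · exact (congrArg Subtype.val h).le
      · exact absurd h (hmin _ hy)
  · obtain ⟨x, hx⟩ := hS
    have key : ∀ y ∈ S, y = t := fun y hy => by
      by_contra hne
      exact h ⟨y, hy, lt_of_le_of_ne (hSt hy) hne⟩
    exact ⟨x, hx, fun y hy => by rw [key y hy, key x hx]⟩

theorem total_of_le (hr : r ≤ t) (hs : s ≤ t) : r ≤ s ∨ s ≤ r := by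
  obtain ⟨m, hm, hmin⟩ := exists_isLeast (t := t) (S := {r, s}) ⟨r, by simp⟩
    (by rintro x (rfl | rfl) <;> assumption)
  rcases hm with rfl | rfl
  · exact Or.inl (hmin (by simp))
  · exact Or.inr (hmin (by simp))

theorem exists_covBy_le (h : s < t) : ∃ r, s ⋖ r ∧ r ≤ t := by
  obtain ⟨r, hr, hmin⟩ := exists_isLeast (t := t) (S := {r | s < r ∧ r ≤ t}) ⟨t, h, le_rfl⟩
    (fun x hx => hx.2)
  exact ⟨r, ⟨hr.1, fun c hc hcr => (hmin ⟨hc, hcr.le.trans hr.2⟩).not_gt hcr⟩, hr.2⟩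

theorem isChain_Iio (t : T) : IsChain (· ≤ ·) (Set.Iio t) :=
  fun _ hr _ hs _ => total_of_le (le_of_lt hr) (le_of_lt hs)

theorem Iio_eq_Iic_iff : Set.Iio t = Set.Iic s ↔ s ⋖ t := by
  constructor
  · intro h
    have hs : s ∈ Set.Iio t := h ▸ Set.mem_Iic.2 le_rfl
    exact ⟨hs, fun c hc hct => (h.subset hct : c ≤ s).not_gt hc⟩
  · intro h
    ext r
    refine ⟨fun hr => ?_, fun hr => lt_of_le_of_lt hr h.1⟩
    rcases total_of_le (le_of_lt hr) h.1.le with h' | h'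
    · exact h'
    · exact (h'.eq_or_lt.resolve_right fun h'' => h.2 h'' hr).symm.le

/-- Every node is a root, a successor or a limit. -/
theorem cases_Iio {T : Type u} [PartialOrder T] (t : T) :
    Set.Iio t = ∅ ∨ (∃ s, s ⋖ t) ∨ ((Set.Iio t).Nonempty ∧ ∀ s < t, ∃ s' < t, s < s') := by
  by_cases h : Set.Iio t = ∅
  · exact Or.inl h
  · refine Or.inr ?_
    by_cases h' : ∀ s < t, ∃ s' < t, s < s'
    · exact Or.inr ⟨Set.nonempty_iff_ne_empty.2 h, h'⟩
    · push Not at h'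
      obtain ⟨s, hs, h'⟩ := h'
      exact Or.inl ⟨s, hs, fun c hc hct => h' c hct hc⟩

theorem wellFounded_lt : WellFounded ((· < ·) : T → T → Prop) := by
  refine WellFounded.wellFounded_iff_has_min.2 fun S ⟨t, ht⟩ => ?_
  obtain ⟨m, hm, hmin⟩ := exists_isLeast (t := t) (S := S ∩ Set.Iic t) ⟨t, ht, le_rfl⟩
    (fun x hx => hx.2)
  exact ⟨m, hm.1, fun x hx hxm => (hmin ⟨hx, hxm.le.trans hm.2⟩).not_gt hxm⟩

/-- The linear order on the predecessors of a node. -/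
noncomputable instance linearOrderIio (t : T) : LinearOrder (Set.Iio t) :=
  { (inferInstance : PartialOrder (Set.Iio t)) with
    le_total := fun a b => show a.1 ≤ b.1 ∨ b.1 ≤ a.1 from
      total_of_le (le_of_lt (Set.mem_Iio.1 a.2)) (le_of_lt (Set.mem_Iio.1 b.2))
    toDecidableLE := Classical.decRel _ }

instance wellFoundedLT_Iio (t : T) : WellFoundedLT (Set.Iio t) :=
  have := IsTreeOrder.wellOrdered t
  ⟨IsWellFounded.wf⟩

theorem isSuccLimit_treeHeight_iff : Order.IsSuccLimit (treeHeight t) ↔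
    (Set.Iio t).Nonempty ∧ ∀ s < t, ∃ s' < t, s < s' := by
  have h1 : Order.IsSuccPrelimit (treeHeight t) ↔ NoMaxOrder (Set.Iio t) :=
    Ordinal.isSuccPrelimit_type_lt_iff (α := Set.Iio t)
  have h2 : treeHeight t ≠ 0 ↔ Nonempty (Set.Iio t) :=
    Ordinal.type_ne_zero_iff_nonempty (α := Set.Iio t) (r := (· < ·))
  rw [Order.isSuccLimit_iff, isMin_iff_eq_bot, Ordinal.bot_eq_zero, h1, ← ne_eq, h2,
    Set.nonempty_coe_sort]
  refine and_congr_right fun _ => ⟨fun h s hs => ?_, fun h => ⟨fun s => ?_⟩⟩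
  · obtain ⟨s', hs'⟩ := h.1 ⟨s, hs⟩
    exact ⟨s'.1, s'.2, hs'⟩
  · obtain ⟨s', hs', h⟩ := h s.1 s.2
    exact ⟨⟨s', hs'⟩, h⟩

theorem cof_treeHeight_le (t : T) : (treeHeight t).cof ≤ #(Set.Iio t) :=
  (Ordinal.cof_type (Set.Iio t)).trans_le (Order.cof_le_cardinalMk _)

theorem le_cof_treeHeight {c : Cardinal.{u}}
    (h : ∀ B ⊆ Set.Iio t, (∀ s < t, ∃ s' ∈ B, s ≤ s') → c ≤ #B) : c ≤ (treeHeight t).cof := by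
  refine le_of_le_of_eq (Order.le_cof_iff.2 fun B hB => ?_) (Ordinal.cof_type (Set.Iio t)).symm
  refine (h (Subtype.val '' B) (by rintro _ ⟨x, -, rfl⟩; exact x.2) fun s hs => ?_).trans
    mk_image_le
  obtain ⟨y, hy, hsy⟩ := hB ⟨s, hs⟩
  exact ⟨y, ⟨y, hy, rfl⟩, hsy⟩

end IsTreeOrder

/-! ### Structure common to all partition trees. -/

namespace PartitionTree

variable {V : Type u} {G : SimpleGraph V} (T : PartitionTree G) {s t : T.Node}

theorem C_subset_of_le (h : s ≤ t) : T.C t ⊆ T.C s := by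
  rcases h.eq_or_lt with rfl | h
  · exact subset_rfl
  · exact ((T.lt_iff s t).1 h).subset

/-- The vertices that lie in `C s` and are not used up at `s`, for all `s ∈ b`. -/
def rest (b : Set T.Node) : Set V := ⋂ s ∈ b, T.C s \ T.part s

theorem mem_rest {b : Set T.Node} {v : V} : v ∈ T.rest b ↔ ∀ s ∈ b, v ∈ T.C s \ T.part s := by
  simp only [rest, Set.mem_iInter]

theorem C_subset_diff_of_lt (h : s < t) : T.C t ⊆ T.C s \ T.part s := by
  obtain ⟨r, hr, hrt⟩ := IsTreeOrder.exists_covBy_le h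
  exact (T.C_subset_of_le hrt).trans (T.succ s r hr).1.subset

theorem rest_empty : T.rest ∅ = Set.univ := by simp [rest]

theorem rest_Iic (s : T.Node) : T.rest (Set.Iic s) = T.C s \ T.part s := by
  ext v
  rw [mem_rest]
  refine ⟨fun h => h s le_rfl, fun h r hr => ?_⟩
  rcases (Set.mem_Iic.1 hr).eq_or_lt with rfl | hr
  · exact h
  · exact T.C_subset_diff_of_lt hr h.1

theorem rest_of_noMax {b : Set T.Node} (h : ∀ s ∈ b, ∃ s' ∈ b, s < s') :
    T.rest b = ⋂ s ∈ b, T.C s := by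
  ext v
  simp only [mem_rest, Set.mem_iInter]
  refine ⟨fun hv s hs => (hv s hs).1, fun hv s hs => ?_⟩
  obtain ⟨s', hs', hss'⟩ := h s hs
  exact T.C_subset_diff_of_lt hss' (hv s' hs')

/-- The root, successor and limit clauses become one statement in terms of `rest`, which spares
later arguments the case distinction. -/
theorem isComponentOf_C (t : T.Node) : IsComponentOf G (T.rest (Set.Iio t)) (T.C t) := by
  rcases IsTreeOrder.cases_Iio t with h | ⟨s, h⟩ | h
  · rw [h, rest_empty]
    exact (T.root t h).1
  · rw [IsTreeOrder.Iio_eq_Iic_iff.2 h, rest_Iic]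
    exact (T.succ s t h).1
  · rw [T.rest_of_noMax (b := Set.Iio t) h.2]
    exact (T.limit t (IsTreeOrder.isSuccLimit_treeHeight_iff.2 h)).1

theorem C_connected (t : T.Node) : (G.induce (T.C t)).Connected := (T.isComponentOf_C t).connected

theorem existsUnique_node {b : Set T.Node} (hb : IsChain (· ≤ ·) b) (hb' : IsLowerSet b)
    {D : Set V} (hD : IsComponentOf G (T.rest b) D) : ∃! t, Set.Iio t = b ∧ T.C t = D := by
  by_cases h0 : b = ∅
  · subst h0
    exact T.root_unique D (by rwa [rest_empty] at hD)
  by_cases h1 : ∀ s ∈ b, ∃ s' ∈ b, s < s'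
  · exact T.limit_unique b hb hb' (Set.nonempty_iff_ne_empty.2 h0) h1 D
      (by rwa [rest_of_noMax T h1] at hD)
  push Not at h1
  obtain ⟨s, hs, hmax⟩ := h1
  have hbs : b = Set.Iic s := by
    ext r
    refine ⟨fun hr => ?_, fun hr => hb' hr hs⟩
    rcases hb.total hr hs with h | h
    · exact h
    · exact (h.eq_or_lt.resolve_right (hmax r hr)).symm.le
  subst hbs
  rw [rest_Iic] at hD
  simpa only [IsTreeOrder.Iio_eq_Iic_iff] using T.succ_unique s D hD

theorem eq_of_Iio_eq (h : Set.Iio s = Set.Iio t) (hC : T.C s = T.C t) : s = t :=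
  (T.existsUnique_node (IsTreeOrder.isChain_Iio t) (isLowerSet_Iio t)
    (T.isComponentOf_C t)).unique ⟨h, hC⟩ ⟨rfl, rfl⟩

/-- Above the same predecessors, two incomparable nodes branch off. -/
theorem exists_branching (h : ¬ (s ≤ t ∨ t ≤ s)) :
    ∃ s' ≤ s, ∃ t' ≤ t, s' ≠ t' ∧ Set.Iio s' = Set.Iio t' := by
  push Not at h
  obtain ⟨s', hs', hmin⟩ := IsTreeOrder.exists_isLeast (t := s) (S := {r | r ≤ s ∧ ¬ r ≤ t})
    ⟨s, le_rfl, h.1⟩ (fun r hr => hr.1)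
  obtain ⟨t', ht', hmin'⟩ := IsTreeOrder.exists_isLeast (t := t) (S := {r | r ≤ t ∧ ¬ r ≤ s})
    ⟨t, le_rfl, h.2⟩ (fun r hr => hr.1)
  refine ⟨s', hs'.1, t', ht'.1, fun he => hs'.2 (he ▸ ht'.1), ?_⟩
  have key : ∀ {a b a' b' : T.Node}, a' ∈ {r | r ≤ a ∧ ¬ r ≤ b} →
      a' ∈ lowerBounds {r | r ≤ a ∧ ¬ r ≤ b} → b' ∈ {r | r ≤ b ∧ ¬ r ≤ a} →
      Set.Iio a' ⊆ Set.Iio b' := by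
    intro a b a' b' ha hla hb r hr
    have hra : r ≤ a := (le_of_lt hr).trans ha.1
    have hrb : r ≤ b := by
      by_contra hrb
      exact (hla ⟨hra, hrb⟩).not_gt hr
    rcases IsTreeOrder.total_of_le hrb hb.1 with hle | hle
    · exact hle.lt_of_ne fun he => hb.2 (he ▸ hra)
    · exact absurd (hle.trans hra) hb.2
  exact subset_antisymm (key hs' hmin ht') (key ht' hmin' hs')

/-- Incomparable nodes lie above distinct nodes with equal predecessors, whose sets are different
components of one set; these neither meet nor are joined. -/
theorem le_or_le_of_touches
    (h : (T.C s ∩ T.C t).Nonempty ∨ SetsJoined G (T.C s) (T.C t)) : s ≤ t ∨ t ≤ s := by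
  by_contra hst
  obtain ⟨s', hs', t', ht', hne, hIio⟩ := T.exists_branching hst
  refine hne (T.eq_of_Iio_eq hIio ((T.isComponentOf_C s').eq_of_touches
    (hIio ▸ T.isComponentOf_C t') ?_))
  have hS := T.C_subset_of_le hs'
  have hT := T.C_subset_of_le ht'
  exact h.imp (fun h => h.mono (Set.inter_subset_inter hS hT)) (fun h => h.mono hS hT)

/-- Every connected set of vertices is hit by the part of a node `t` with `X ⊆ C t`. -/
theorem exists_node_of_connected {X : Set V} (hX : (G.induce X).Connected) :
    ∃ t, X ⊆ T.C t ∧ (X ∩ T.part t).Nonempty := by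
  obtain ⟨x, hx⟩ := nonempty_of_connected_induce hX
  -- The nodes whose set contains `X` and whose part misses it form an initial chain; the wanted
  -- node is the one directly above this chain, for the component containing `X`.
  set b : Set T.Node := {t | X ⊆ T.C t \ T.part t} with hb
  have hchain : IsChain (· ≤ ·) b := fun s hs t ht _ =>
    T.le_or_le_of_touches (Or.inl ⟨x, (hs hx).1, (ht hx).1⟩)
  have hlower : IsLowerSet b := by
    intro t s hst ht
    rcases hst.eq_or_lt with rfl | hst
    · exact ht
    · exact (ht.trans Set.sdiff_subset).trans (T.C_subset_diff_of_lt hst)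
  obtain ⟨D, hD, hXD⟩ := exists_isComponentOf (S := T.rest b)
    (fun y hy => T.mem_rest.2 fun s hs => hs hy) hX
  obtain ⟨t, ⟨ht, rfl⟩, -⟩ := T.existsUnique_node hchain hlower hD
  refine ⟨t, hXD, ?_⟩
  by_contra hne
  have : t ∈ b := fun y hy => ⟨hXD hy, fun hy' => hne ⟨y, hy, hy'⟩⟩
  rw [← ht] at this
  exact lt_irrefl t this

/-- The part of a node is a singleton, or bounded by the number of predecessors. -/
theorem mk_part_le (t : T.Node) : #(T.part t) ≤ 1 ∨ #(T.part t) ≤ #(Set.Iio t) := by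
  rcases IsTreeOrder.cases_Iio t with h | ⟨s, h⟩ | h
  · obtain ⟨-, x, -, hx, -⟩ := T.root t h
    exact Or.inl (by rw [hx, mk_singleton])
  · obtain ⟨-, x, -, hx, -⟩ := T.succ s t h
    exact Or.inl (by rw [hx, mk_singleton])
  · exact Or.inr ((T.limit t (IsTreeOrder.isSuccLimit_treeHeight_iff.2 h)).2.2.2.1.trans
      (IsTreeOrder.cof_treeHeight_le t))

end PartitionTree

/-! ### Large branches from complete minors. -/

theorem exists_isBranch_of_isChain {P : Type u} [PartialOrder P] {c : Set P}
    (hc : IsChain (· ≤ ·) c) : ∃ b, IsBranch b ∧ c ⊆ b := by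
  obtain ⟨b, hb, h⟩ := hc.exists_maxChain
  exact ⟨b, hb, h⟩

theorem exists_large_branch_of_minor {κ : Cardinal.{u}} (hκ : κ.IsRegular) {V : Type u}
    {G : SimpleGraph V} (hG : IsGraphMinor (completeGraphOn κ) G) (T : PartitionTree G) :
    ∃ b : Set T.Node, IsBranch b ∧ κ ≤ #b := by
  suffices ∃ c : Set T.Node, IsChain (· ≤ ·) c ∧ κ ≤ #c by
    obtain ⟨c, hc, hcκ⟩ := this
    obtain ⟨b, hb, hcb⟩ := exists_isBranch_of_isChain hc
    exact ⟨b, hb, hcκ.trans (mk_le_mk_of_subset hcb)⟩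
  obtain ⟨X, hX, hdisj, hjoin⟩ := hG
  choose f hf hf' using fun i => T.exists_node_of_connected (hX i)
  -- Reindexing by `κ.ord.ToType` brings the indices down to universe `u`, where `Set.Iio κ.ord`
  -- does not live.
  let g : κ.ord.ToType → T.Node := fun i => f (Ordinal.ToType.mk.symm i)
  have hchain : IsChain (· ≤ ·) (Set.range g) := by
    rintro _ ⟨i, rfl⟩ _ ⟨j, rfl⟩ hne
    refine T.le_or_le_of_touches (Or.inr ((hjoin _ _ ?_).mono (hf _) (hf _)))
    exact fun h => hne (by simp only [g, h])
  by_cases hr : κ ≤ #(Set.range g)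
  · exact ⟨_, hchain, hr⟩
  obtain ⟨t, ht⟩ := infinite_pigeonhole_card (Set.rangeFactorization g) κ (by simp) hκ.aleph0_le
    (by rw [hκ.cof_ord]; exact not_le.1 hr)
  have hpart : κ ≤ #(T.part t.1) := by
    refine ht.trans ?_
    have hg : ∀ i : Set.rangeFactorization g ⁻¹' {t}, g i = t.1 := fun i => congrArg Subtype.val i.2
    choose x hx using fun i : κ.ord.ToType => hf' (Ordinal.ToType.mk.symm i)
    refine mk_le_of_injective (f := fun i => ⟨x i, hg i ▸ (hx i).2⟩) fun i j hij => ?_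
    have hij : x i = x j := congrArg Subtype.val hij
    by_contra hne
    refine Set.disjoint_left.1 (hdisj _ _ ?_) (hx i).1 (hij ▸ (hx j).1)
    exact fun h => hne (Subtype.ext (Ordinal.ToType.mk.symm.injective h))
  refine ⟨Set.Iio t.1, IsTreeOrder.isChain_Iio _, ?_⟩
  -- A singleton part is too small for `κ`, so the part is bounded by the number of predecessors.
  rcases T.mk_part_le t.1 with h | h
  · exact absurd (hpart.trans h) (not_le.2 (by simpa using hκ.nat_lt 1))
  · exact hpart.trans h

/-! ### The complete bipartite graph and its partition trees. -/

section CompleteBipartite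

variable {κ : Cardinal.{u}} {α : Type u}

/-- Non-adjacent vertices lie on the same side and so have the same neighbours. -/
theorem adj_of_not_adj_completeBipartiteGraph {m x y : α ⊕ α}
    (h : ¬ (completeBipartiteGraph α α).Adj m x) (hxy : (completeBipartiteGraph α α).Adj x y) :
    (completeBipartiteGraph α α).Adj m y := by
  rcases m with m | m <;> rcases x with x | x <;> rcases y with y | y <;>
    simp_all [completeBipartiteGraph]

theorem connected_induce_compl_completeBipartiteGraph (hα : #α = κ) {A : Set (α ⊕ α)}
    (hA : #A < κ) : ((completeBipartiteGraph α α).induce Aᶜ).Connected := by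
  have key : ∀ i : α → α ⊕ α, Function.Injective i → ∃ a, i a ∉ A := by
    intro i hi
    by_contra! h
    exact hA.not_ge (hα ▸ mk_le_of_injective (f := fun a => (⟨i a, h a⟩ : A))
      fun a b hab => hi (congrArg Subtype.val hab))
  obtain ⟨a, ha⟩ := key Sum.inl Sum.inl_injective
  obtain ⟨b, hb⟩ := key Sum.inr Sum.inr_injective
  have hr : ∀ y (hy : Sum.inr y ∈ Aᶜ), ((completeBipartiteGraph α α).induce Aᶜ).Adj
      ⟨Sum.inl a, ha⟩ ⟨Sum.inr y, hy⟩ := fun y hy => by simp [completeBipartiteGraph]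
  refine SimpleGraph.connected_iff_exists_forall_reachable _ |>.2 ⟨⟨Sum.inl a, ha⟩, ?_⟩
  rintro ⟨x | y, h⟩
  · refine (hr b hb).reachable.trans (SimpleGraph.Adj.reachable ?_)
    simp [completeBipartiteGraph]
  · exact (hr y h).reachable

end CompleteBipartite

/-- Proper initial segments of the initial ordinal `(#V).ord` are smaller than `#V`; adding one
point does not matter as `#V` is infinite. -/
theorem mk_enum_le_lt {V : Type u} (hV : ℵ₀ ≤ #V) (e : V ≃ Set.Iio (#V).ord) (v : V) :
    #{z | e z ≤ e v} < #V := by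
  have h : #{z | e z < e v} < #V := by
    refine lt_of_le_of_lt ?_
      ((mk_Iio_lt (Ordinal.ToType.mk (e v)) (by simp)).trans_eq (mk_ord_toType _))
    refine mk_le_of_injective (f := fun z : {z | e z < e v} =>
      (⟨Ordinal.ToType.mk (e z), Ordinal.ToType.mk.lt_iff_lt.2 z.2⟩ :
        Set.Iio (Ordinal.ToType.mk (e v)))) fun z z' h => ?_
    exact Subtype.ext (e.injective (Ordinal.ToType.mk.injective (congrArg Subtype.val h)))
  have hsub : {z | e z ≤ e v} ⊆ insert v {z | e z < e v} := fun z hz =>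
    (le_iff_eq_or_lt.1 (show e z ≤ e v from hz)).imp (fun h => e.injective h) id
  exact (mk_le_mk_of_subset hsub).trans_lt
    (mk_insert_le.trans_lt (add_lt_of_lt hV h (one_lt_aleph0.trans_le hV)))

theorem exists_least_of_enum {V : Type u} (e : V ≃ Set.Iio (#V).ord) {C : Set V} (hC : C.Nonempty) : ∃ m ∈ C, ∀ z ∈ C, e m ≤ e z := by
  obtain ⟨m, hm, hmin⟩ := (InvImage.wf e
    (IsWellFounded.wf (r := ((· < ·) : Set.Iio (#V).ord → _ → Prop)))).has_min C hC
  exact ⟨m, hm, fun z hz => not_lt.1 (hmin z hz)⟩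

namespace PartitionTree

theorem mk_part_lt {V : Type u} {G : SimpleGraph V} (T : PartitionTree G)
    {κ : Cardinal.{u}} (hκ : κ.IsRegular) {t : T.Node} (ht : #(Set.Iio t) < κ) :
    #(T.part t) < κ := by
  rcases T.mk_part_le t with h | h
  · exact h.trans_lt (by simpa using hκ.nat_lt 1)
  · exact h.trans_lt ht

variable {κ : Cardinal.{u}} {α : Type u} (T : PartitionTree (completeBipartiteGraph α α))
  {a s t : T.Node}

/-- In a complete bipartite graph, the least vertex is used up after at most two steps. -/
theorem least_mem_part (has : a ⋖ s) (hst : s ⋖ t) {m : α ⊕ α} (hm : m ∈ T.C t)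
    (hmin : ∀ z ∈ T.C s, T.enum m ≤ T.enum z) : m ∈ T.part t := by
  have hms := T.C_subset_diff_of_lt hst.1 hm
  obtain ⟨-, x, y, hx, hy, hax, hdist⟩ := T.succ a s has
  obtain ⟨-, x', y', hx', hy', hsx, hdist'⟩ := T.succ s t hst
  have hym : y = ⟨m, hms.1⟩ :=
    Subtype.ext (T.enum.injective (le_antisymm (hy m hms.1) (hmin y y.2)))
  have hym' : y' = ⟨m, hm⟩ := Subtype.ext (T.enum.injective
    (le_antisymm (hy' m hm) (hmin y' (T.C_subset_of_le hst.1.le y'.2))))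
  subst hym hym'
  -- If `m` is adjacent to the vertex `x` used at `s`, it is eligible at `t` with distance `0` and
  -- is chosen there. Otherwise it shares the neighbours of `x`, was eligible at `s`, and was
  -- already chosen there.
  by_cases hadj : (completeBipartiteGraph α α).Adj m x.1
  · have h0 := hdist' ⟨m, hm⟩ ⟨x.1, by rw [hx]; rfl, m, rfl, hadj.symm⟩
    rw [SimpleGraph.dist_self, Nat.le_zero, (T.C_connected t).dist_eq_zero_iff] at h0
    rw [hx', h0]
    rfl
  · obtain ⟨w, hw, _, rfl, hwx⟩ := hax
    have h0 := hdist ⟨m, hms.1⟩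
      ⟨w, hw, m, rfl, (adj_of_not_adj_completeBipartiteGraph hadj hwx.symm).symm⟩
    rw [SimpleGraph.dist_self, Nat.le_zero, (T.C_connected s).dist_eq_zero_iff] at h0
    refine absurd ?_ hms.2
    rw [hx, h0]
    rfl

/-- The least vertices of the sets below `t` all come no later than a fixed `v ∈ C t`, so with `κ`
predecessors one least vertex would repeat `κ` times. By `least_mem_part` it cannot survive that
long. -/
theorem mk_Iio_lt (hκ : κ.IsRegular) (hα : #α = κ) (t : T.Node) : #(Set.Iio t) < κ := by
  by_contra! hcard
  have hV : #(α ⊕ α) = κ := by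
    rw [mk_sum, hα, lift_id, add_eq_self hκ.aleph0_le]
  obtain ⟨v, hv⟩ := (T.isComponentOf_C t).nonempty
  choose m hm hmin using fun s =>
    exists_least_of_enum T.enum (T.isComponentOf_C s).nonempty
  let f : Set.Iio t → {z | T.enum z ≤ T.enum v} := fun s =>
    ⟨m s, hmin s v (T.C_subset_of_le (le_of_lt s.2) hv)⟩
  obtain ⟨z, hz⟩ := infinite_pigeonhole_card f κ hcard hκ.aleph0_le
    (by rw [hκ.cof_ord, ← hV]; exact mk_enum_le_lt (hV ▸ hκ.aleph0_le) T.enum v)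
  have hinf : (f ⁻¹' {z}).Infinite :=
    Set.infinite_coe_iff.1 (infinite_iff.2 (hκ.aleph0_le.trans hz))
  -- Four nodes with the same least vertex leave room for two consecutive successor steps above the
  -- first one, with the vertex still unused strictly later.
  obtain ⟨F, hF, hF4⟩ := hinf.exists_subset_card_eq 4
  let g := F.orderEmbOfFin hF4
  have hg : ∀ i, m (g i).1 = z.1 := fun i =>
    congrArg Subtype.val (hF (F.orderEmbOfFin_mem hF4 i) : f (g i) = z)
  have hlt : ∀ {i j}, i < j → (g i).1 < (g j).1 := fun h => g.lt_iff_lt.2 h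
  obtain ⟨b, hab, hb⟩ := IsTreeOrder.exists_covBy_le (hlt (show (0 : Fin 4) < 1 by decide))
  obtain ⟨c, hbc, hc⟩ := IsTreeOrder.exists_covBy_le
    (hb.trans_lt (hlt (show (1 : Fin 4) < 2 by decide)))
  have h3 := T.C_subset_diff_of_lt (hc.trans_lt (hlt (show (2 : Fin 4) < 3 by decide)))
    (hm (g 3).1)
  rw [hg] at h3
  refine h3.2 (T.least_mem_part hab hbc h3.1 fun x hx => ?_)
  rw [← hg 0]
  exact hmin _ x (T.C_subset_of_le hab.1.le hx)

theorem mk_biUnion_part_lt (hκ : κ.IsRegular) (hα : #α = κ) {b : Set T.Node} (hb : #b < κ) :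
    #(⋃ s ∈ b, T.part s : Set (α ⊕ α)) < κ :=
  (card_biUnion_lt_iff_forall_of_isRegular hκ hb).2 fun s _ =>
    T.mk_part_lt hκ (T.mk_Iio_lt hκ hα s)

/-- By induction `C t` is a component of the complement of the parts used so far, and fewer than `κ`
deletions leave that complement connected. -/
theorem C_eq_compl (hκ : κ.IsRegular) (hα : #α = κ) (t : T.Node) :
    T.C t = (⋃ s ∈ Set.Iio t, T.part s)ᶜ := by
  refine IsTreeOrder.wellFounded_lt.induction
    (C := fun t => T.C t = (⋃ s ∈ Set.Iio t, T.part s)ᶜ) t fun t ih => ?_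
  have hrest : T.rest (Set.Iio t) = (⋃ s ∈ Set.Iio t, T.part s)ᶜ := by
    ext v
    simp only [mem_rest, Set.mem_compl_iff, Set.mem_iUnion, not_exists]
    refine ⟨fun h s hs => (h s hs).2, fun h s hs => ⟨?_, h s hs⟩⟩
    rw [ih s hs]
    simp only [Set.mem_compl_iff, Set.mem_iUnion, not_exists]
    exact fun r hr => h r (lt_trans hr hs)
  refine ((T.isComponentOf_C t).eq_of_connected ?_).trans hrest
  rw [hrest]
  exact connected_induce_compl_completeBipartiteGraph hα
    (T.mk_biUnion_part_lt hκ hα (T.mk_Iio_lt hκ hα t))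

theorem le_total_of_completeBipartiteGraph (hκ : κ.IsRegular) (hα : #α = κ) (s t : T.Node) :
    s ≤ t ∨ t ≤ s := by
  by_contra hst
  obtain ⟨s', -, t', -, hne, hIio⟩ := T.exists_branching hst
  exact hne (T.eq_of_Iio_eq hIio (by rw [T.C_eq_compl hκ hα, T.C_eq_compl hκ hα, hIio]))

/-- With fewer than `κ` nodes a connected remainder is left above all of them, and it would require
a further node. -/
theorem le_mk_node (hκ : κ.IsRegular) (hα : #α = κ) : κ ≤ #T.Node := by
  by_contra! h
  have hrest : T.rest Set.univ = (⋃ s ∈ (Set.univ : Set T.Node), T.part s)ᶜ := by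
    ext v
    simp only [mem_rest, Set.mem_compl_iff, Set.mem_iUnion, not_exists]
    refine ⟨fun h s hs => (h s hs).2, fun h s hs => ⟨?_, h s hs⟩⟩
    rw [T.C_eq_compl hκ hα]
    simp only [Set.mem_compl_iff, Set.mem_iUnion, not_exists]
    exact fun r _ => h r trivial
  have hconn := connected_induce_compl_completeBipartiteGraph hα
    (T.mk_biUnion_part_lt hκ hα (b := Set.univ) (by rwa [mk_univ]))
  rw [← hrest] at hconn
  obtain ⟨t, ⟨ht, -⟩, -⟩ := T.existsUnique_node
    (fun s _ t _ _ => T.le_total_of_completeBipartiteGraph hκ hα s t) isLowerSet_univ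
    (D := T.rest Set.univ) ⟨⟨subset_rfl, hconn⟩, fun _ h _ => h.1⟩
  exact lt_irrefl t (show t ∈ Set.Iio t from ht ▸ Set.mem_univ t)

theorem nonempty_orderIso (hκ : κ.IsRegular) (hα : #α = κ) :
    Nonempty (T.Node ≃o Set.Iio κ.ord) := by
  let _ : LinearOrder T.Node :=
    { T.order with
      le_total := T.le_total_of_completeBipartiteGraph hκ hα
      toDecidableLE := Classical.decRel _ }
  have : WellFoundedLT T.Node := ⟨IsTreeOrder.wellFounded_lt⟩
  -- Proper initial segments have fewer than `κ` elements and the whole has at least `κ`.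
  have htype : Ordinal.type ((· < ·) : T.Node → T.Node → Prop) = κ.ord := by
    refine le_antisymm (le_of_forall_lt fun o ho => ?_)
      ((ord_le_ord.2 (T.le_mk_node hκ hα)).trans (ord_le_type _))
    obtain ⟨t, rfl⟩ := Ordinal.typein_surj _ ho
    rw [lt_ord, Ordinal.card_typein]
    exact T.mk_Iio_lt hκ hα t
  rw [← Ordinal.type_toType κ.ord, Ordinal.type_eq] at htype
  obtain ⟨e⟩ := htype
  exact ⟨(OrderIso.ofRelIsoLT e).trans Ordinal.ToType.mk.symm⟩

end PartitionTree

theorem exists_bipartite_partitionTree {κ : Cardinal.{u}} (hκ : κ.IsRegular) :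
    ∃ (V : Type u) (G : SimpleGraph V), G.chromaticNumber = 2 ∧
      (∃ S : Set V, G.IsIndepSet S ∧ #S = κ) ∧
      ∀ T : PartitionTree G, Nonempty (T.Node ≃o Set.Iio κ.ord) := by
  have hα : #κ.ord.ToType = κ := mk_ord_toType κ
  have : Nonempty κ.ord.ToType := mk_ne_zero_iff.1 (hα.trans_ne hκ.ne_zero)
  refine ⟨κ.ord.ToType ⊕ κ.ord.ToType, completeBipartiteGraph _ _,
    SimpleGraph.CompleteBipartiteGraph.chromaticNumber, ⟨Set.range Sum.inl, ?_, ?_⟩,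
    fun T => T.nonempty_orderIso hκ hα⟩
  · rintro _ ⟨x, rfl⟩ _ ⟨y, rfl⟩ -
    simp [completeBipartiteGraph]
  · rw [mk_range_eq _ Sum.inl_injective, hα]

theorem isBranchOfLength_univ {κ : Cardinal.{u}} {P : Type u} [PartialOrder P]
    (e : P ≃o Set.Iio κ.ord) : IsBranchOfLength κ (Set.univ : Set P) := by
  refine ⟨⟨fun s _ t _ _ => ?_, fun b _ hb => (Set.eq_univ_of_univ_subset hb).symm⟩,
    ⟨OrderIso.Set.univ.trans e⟩⟩
  exact (le_total (e s) (e t)).imp e.le_iff_le.1 e.le_iff_le.1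

/-! ### Existence: carrying out the construction. -/

theorem exists_finite_connected {V : Type u} {G : SimpleGraph V} {C : Set V}
    (hC : (G.induce C).Connected) {x y : V} (hx : x ∈ C) (hy : y ∈ C) :
    ∃ W ⊆ C, W.Finite ∧ x ∈ W ∧ y ∈ W ∧ (G.induce W).Connected := by
  obtain ⟨p⟩ := hC.preconnected ⟨x, hx⟩ ⟨y, hy⟩
  let q := p.map (SimpleGraph.Embedding.induce C).toHom
  refine ⟨{z | z ∈ q.support}, fun z hz => ?_, List.finite_toSet _, q.start_mem_support,
    q.end_mem_support, q.connected_induce_support⟩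
  have hz : z ∈ q.support := hz
  rw [SimpleGraph.Walk.support_map, List.mem_map] at hz
  obtain ⟨a, -, rfl⟩ := hz
  exact a.2

namespace BrochetDiestel

variable {V : Type u} (G : SimpleGraph V) (e : V ≃ Set.Iio (#V).ord)

/-- The requirements on the set `P` of vertices used up at a node with vertex set `C`, where `h`
consists of the pairs of sets belonging to the predecessors of the node. -/
structure IsPartChoice (h : Set (Set V × Set V)) (C P : Set V) : Prop where
  subset : P ⊆ C
  connected : (G.induce P).Connected
  root : h = ∅ → ∃ x ∈ C, P = {x} ∧ ∀ z ∈ C, e x ≤ e z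
  succ : ∀ p ∈ h, (∀ q ∈ h, p.1 ⊆ q.1) → ∃ x y : C, P = {x.1} ∧ (∀ z ∈ C, e y.1 ≤ e z) ∧
    SetsJoined G p.2 {x.1} ∧ ∀ x' : C, SetsJoined G p.2 {x'.1} →
      (G.induce C).dist x y ≤ (G.induce C).dist x' y
  limit : h.Nonempty → (∀ p ∈ h, ∃ q ∈ h, q.1 ⊂ p.1) →
    (∀ p ∈ h, ∃ q ∈ h, q.1 ⊆ p.1 ∧ SetsJoined G q.2 P) ∧
    ∀ B ⊆ h, (∀ p ∈ h, ∃ q ∈ B, q.1 ⊆ p.1) → #P ≤ #B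

variable {G}

theorem exists_isPartChoice_root {C : Set V} (hC : C.Nonempty) :
    ∃ P, IsPartChoice G e ∅ C P := by
  obtain ⟨m, hm, hmin⟩ := exists_least_of_enum e hC
  exact ⟨{m}, Set.singleton_subset_iff.2 hm, connected_induce_singleton G m,
    fun _ => ⟨m, hm, rfl, hmin⟩, fun p hp => hp.elim, fun h => absurd h Set.not_nonempty_empty⟩

theorem exists_isPartChoice_succ {h : Set (Set V × Set V)} {C : Set V} {p : Set V × Set V}
    (hp : p ∈ h) (hmin : ∀ q ∈ h, q.1 ⊆ p.1 → q = p) (hj : SetsJoined G p.2 C) :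
    ∃ P, IsPartChoice G e h C P := by
  obtain ⟨w, hw, x₀, hx₀, hadj⟩ := hj
  obtain ⟨m, hm, hmin'⟩ := exists_least_of_enum e ⟨x₀, hx₀⟩
  obtain ⟨x, hx, hdist⟩ := (InvImage.wf (fun x : C => (G.induce C).dist x ⟨m, hm⟩)
    (IsWellFounded.wf (r := ((· < ·) : ℕ → ℕ → Prop)))).has_min {x | SetsJoined G p.2 {x.1}}
    ⟨⟨x₀, hx₀⟩, w, hw, x₀, rfl, hadj⟩
  refine ⟨{x.1}, Set.singleton_subset_iff.2 x.2, connected_induce_singleton G _,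
    fun h0 => (h0 ▸ hp : p ∈ (∅ : Set _)).elim, fun q hq hq' => ?_, fun _ hlim => ?_⟩
  · obtain rfl := hmin q hq (hq' p hp)
    exact ⟨x, ⟨m, hm⟩, rfl, hmin', hx, fun x' hx' => not_lt.1 (hdist x' hx')⟩
  · obtain ⟨q, hq, hqp⟩ := hlim p hp
    exact absurd (congrArg Prod.fst (hmin q hq hqp.subset)) hqp.ne

/-- For a cofinal `B ⊆ h` of least size, finitely many vertices per element of `B` connect a fixed
vertex of `C` to a neighbour of a part beyond that element. Since `B` is infinite, the union has
size at most `#B`. -/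
theorem exists_isPartChoice_limit {h : Set (Set V × Set V)} {C : Set V} (hh : h.Nonempty)
    (hlim : ∀ p ∈ h, ∃ q ∈ h, q.1 ⊂ p.1) (hC : (G.induce C).Connected)
    (hj : ∀ p ∈ h, ∃ q ∈ h, q.1 ⊆ p.1 ∧ SetsJoined G q.2 C) :
    ∃ P, IsPartChoice G e h C P := by
  obtain ⟨B, ⟨hBh, hB⟩, hBmin⟩ := (InvImage.wf (fun B : Set (Set V × Set V) => #B)
    Cardinal.lt_wf).has_min {B | B ⊆ h ∧ ∀ p ∈ h, ∃ q ∈ B, q.1 ⊆ p.1}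
    ⟨h, subset_rfl, fun p hp => ⟨p, hp, subset_rfl⟩⟩
  obtain ⟨p₀, hp₀⟩ := hh
  obtain ⟨q₀, hq₀, -⟩ := hB p₀ hp₀
  -- A finite cofinal set would contain a minimal vertex set, although `h` always has strictly
  -- smaller ones.
  have hBinf : B.Infinite := by
    intro hfin
    obtain ⟨p, hp, hpmin⟩ := hfin.exists_minimalFor Prod.fst B ⟨q₀, hq₀⟩
    obtain ⟨q, hq, hqp⟩ := hlim p (hBh hp)
    obtain ⟨r, hr, hrq⟩ := hB q hq
    exact (hrq.trans_ssubset hqp).not_subset (hpmin hr (hrq.trans hqp.subset))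
  have hBinf : ℵ₀ ≤ #B := infinite_iff.1 hBinf.to_subtype
  obtain ⟨x₀, hx₀⟩ := nonempty_of_connected_induce hC
  have hW : ∀ p : B, ∃ W ⊆ C, W.Finite ∧ x₀ ∈ W ∧ (G.induce W).Connected ∧
      ∃ q ∈ h, q.1 ⊆ p.1.1 ∧ SetsJoined G q.2 W := by
    intro p
    obtain ⟨q, hq, hqp, w, hw, x, hx, hadj⟩ := hj p (hBh p.2)
    obtain ⟨W, hWC, hWfin, hx₀W, hxW, hWc⟩ := exists_finite_connected hC hx₀ hx
    exact ⟨W, hWC, hWfin, hx₀W, hWc, q, hq, hqp, w, hw, x, hxW, hadj⟩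
  choose W hWC hWfin hx₀W hWc hWj using hW
  have hle : #(⋃ p, W p) ≤ #B := by
    refine (mk_iUnion_le W).trans ((mul_le_mul' le_rfl (ciSup_le' fun p =>
      (hWfin p).lt_aleph0.le)).trans ?_)
    rw [mul_aleph0_eq hBinf]
  refine ⟨⋃ p, W p, Set.iUnion_subset hWC, ?_, fun h0 => ?_, fun p hp hp' => ?_,
    fun _ _ => ⟨fun p hp => ?_, fun B' hB'h hB' => hle.trans (not_lt.1 (hBmin B' ⟨hB'h, hB'⟩))⟩⟩
  · rw [← Set.sUnion_range]
    refine SimpleGraph.induce_sUnion_connected_of_pairwise_not_disjoint ⟨_, ⟨q₀, hq₀⟩, rfl⟩ ?_ ?_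
    · rintro _ _ ⟨p, rfl⟩ ⟨q, rfl⟩
      exact ⟨x₀, hx₀W p, hx₀W q⟩
    · rintro _ ⟨p, rfl⟩
      exact hWc p
  · exact (h0 ▸ hp₀ : p₀ ∈ (∅ : Set _)).elim
  · obtain ⟨q, hq, hqp⟩ := hlim p hp
    exact absurd (hp' q hq) hqp.not_subset
  · obtain ⟨q, hq, hqp⟩ := hB p hp
    obtain ⟨r, hr, hrq, hrj⟩ := hWj ⟨q, hq⟩
    exact ⟨r, hr, hrq.trans hqp, hrj.mono subset_rfl (Set.subset_iUnion W ⟨q, hq⟩)⟩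

variable (G)

/-- The vertices left over by the pairs in `h`. -/
def remainder (h : Set (Set V × Set V)) : Set V := ⋂ p ∈ h, p.1 \ p.2

/-- The pair of sets that belongs to `v` after the pairs in `h`. -/
noncomputable def step (v : V) (h : Set (Set V × Set V)) : Set V × Set V :=
  (componentAt G (remainder h) v,
    Classical.epsilon (IsPartChoice G e h (componentAt G (remainder h) v)))

/-- The pair of sets belonging to the node of height `α` whose vertex set contains `v`. There is
such a node exactly if `v` belongs to the first component. -/
noncomputable def level (v : V) : Ordinal.{u} → Set V × Set V :=
  WellFounded.fix (wellFounded_lt (α := Ordinal.{u})) fun _ ih => step G e v {p | ∃ β hβ, ih β hβ = p}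

/-- The pairs of sets belonging to the nodes below height `α` whose vertex sets contain `v`. -/
noncomputable def history (v : V) (α : Ordinal.{u}) : Set (Set V × Set V) :=
  level G e v '' Set.Iio α

variable {G e} {v w x : V} {α β γ : Ordinal.{u}}

theorem mem_remainder {h : Set (Set V × Set V)} : x ∈ remainder h ↔ ∀ p ∈ h, x ∈ p.1 \ p.2 := by
  simp only [remainder, Set.mem_iInter]

theorem mem_remainder_history :
    x ∈ remainder (history G e v α) ↔ ∀ β < α, x ∈ (level G e v β).1 \ (level G e v β).2 := by
  rw [mem_remainder, history, Set.forall_mem_image]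
  rfl

theorem level_eq (v : V) (α : Ordinal.{u}) : level G e v α = step G e v (history G e v α) := by
  rw [level, WellFounded.fix_eq]
  congr 1
  ext p
  simp only [history, Set.mem_image, Set.mem_Iio, exists_prop]
  rfl

theorem level_fst (v : V) (α : Ordinal.{u}) :
    (level G e v α).1 = componentAt G (remainder (history G e v α)) v := by
  rw [level_eq]
  rfl

theorem mem_level_iff : v ∈ (level G e v α).1 ↔ v ∈ remainder (history G e v α) := by
  rw [level_fst, mem_componentAt_iff]

theorem level_subset_diff (h : β < α) :
    (level G e v α).1 ⊆ (level G e v β).1 \ (level G e v β).2 := fun x hx => by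
  rw [level_fst] at hx
  exact mem_remainder_history.1 (componentAt_subset _ _ _ hx) β h

theorem level_subset (h : β ≤ α) : (level G e v α).1 ⊆ (level G e v β).1 := by
  rcases h.eq_or_lt with rfl | h
  · exact subset_rfl
  · exact (level_subset_diff h).trans Set.sdiff_subset

theorem isComponentOf_level (hv : v ∈ (level G e v α).1) :
    IsComponentOf G (remainder (history G e v α)) (level G e v α).1 := by
  rw [level_fst]
  exact isComponentOf_componentAt (mem_level_iff.1 hv)

theorem mem_level_of_mem (hw : w ∈ (level G e v α).1) : v ∈ (level G e v α).1 := by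
  rw [level_fst] at hw
  obtain ⟨E, hE, -⟩ := hw
  exact mem_level_iff.2 (hE.1 hE.2.1)

/-- `v` enters a step only through its component, so by induction two vertices in the same component
at level `α` have the same pairs up to there. -/
theorem level_congr (hw : w ∈ (level G e v α).1) (h : β ≤ α) : level G e w β = level G e v β := by
  induction β using WellFoundedLT.induction with
  | _ β ih =>
    have hh : history G e w β = history G e v β :=
      Set.image_congr fun γ hγ => ih γ hγ ((le_of_lt hγ).trans h)
    have hC : componentAt G (remainder (history G e v β)) v =
        componentAt G (remainder (history G e v β)) w := by
      rw [← level_fst]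
      exact (isComponentOf_level (level_subset h (mem_level_of_mem hw))).eq_componentAt
        (level_subset h hw)
    rw [level_eq, level_eq, hh, step, step, hC]

/-- The vertex set of a node is joined to cofinally many of the sets used up below it. -/
theorem exists_setsJoined_level (hv : v ∈ (level G e v α).1)
    (ih : ∀ γ < α, IsPartChoice G e (history G e v γ) (level G e v γ).1 (level G e v γ).2)
    (hβ : β < α) : ∃ γ < α, β ≤ γ ∧ SetsJoined G (level G e v γ).2 (level G e v α).1 := by
  have hmem : ∀ {γ}, γ ≤ α → v ∈ (level G e v γ).1 := fun h => level_subset h hv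
  obtain ⟨y₀, hy₀⟩ := nonempty_of_connected_induce (ih β hβ).connected
  -- An edge inside the set of level `β` leaves the set of level `α` at `y`. At the first level `γ`
  -- where `y` does not survive, its neighbour `x` keeps it in the component, so `y` must lie in the
  -- part of level `γ`.
  obtain ⟨x, ⟨-, hx⟩, y, ⟨hyβ, hyα⟩, hadj⟩ := exists_adj_of_connected_induce
    (isComponentOf_level (hmem hβ.le)).connected (A := (level G e v α).1) ⟨v, hmem hβ.le, hv⟩
    ⟨y₀, (ih β hβ).subset hy₀, fun h => (level_subset_diff hβ h).2 hy₀⟩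
  have key : ∀ γ ≤ α, y ∈ remainder (history G e v γ) → y ∈ (level G e v γ).1 := by
    intro γ hγ hy
    exact (isComponentOf_level (hmem hγ)).subset_of_touches (Set.singleton_subset_iff.2 hy)
      (connected_induce_singleton G y) (Or.inr ⟨x, level_subset hγ hx, y, rfl, hadj⟩) rfl
  have hex : ∃ γ, γ < α ∧ y ∉ (level G e v γ).1 \ (level G e v γ).2 := by
    by_contra! hne
    exact hyα (key α le_rfl (mem_remainder_history.2 hne))
  obtain ⟨γ, ⟨hγ, hyγ⟩, hmin⟩ := WellFounded.has_min
    (wellFounded_lt (α := Ordinal.{u})) {γ | γ < α ∧ y ∉ (level G e v γ).1 \ (level G e v γ).2} hex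
  have hyγ' : y ∈ (level G e v γ).1 := key γ hγ.le (mem_remainder_history.2 fun δ hδ => by
    by_contra hy
    exact hmin δ ⟨hδ.trans hγ, hy⟩ hδ)
  refine ⟨γ, hγ, not_lt.1 fun h => hyγ (level_subset_diff h hyβ), y, ?_, x, hx, hadj.symm⟩
  by_contra hy
  exact hyγ ⟨hyγ', hy⟩

theorem isPartChoice_level (hv : v ∈ (level G e v α).1) :
    IsPartChoice G e (history G e v α) (level G e v α).1 (level G e v α).2 := by
  induction α using WellFoundedLT.induction with
  | _ α ih =>
    have ih : ∀ γ < α, IsPartChoice G e (history G e v γ) (level G e v γ).1 (level G e v γ).2 :=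
      fun γ hγ => ih γ hγ (level_subset hγ.le hv)
    have hss : ∀ {γ β}, γ < β → β < α → (level G e v β).1 ⊂ (level G e v γ).1 := by
      intro γ β hγ hβ
      obtain ⟨y, hy⟩ := nonempty_of_connected_induce (ih γ (hγ.trans hβ)).connected
      exact ⟨level_subset hγ.le, fun h =>
        (level_subset_diff hγ (h ((ih γ (hγ.trans hβ)).subset hy))).2 hy⟩
    -- The part is an `epsilon` term, so the existence of a suitable set is enough.
    suffices ∃ P, IsPartChoice G e (history G e v α) (level G e v α).1 P by
      rw [level_fst] at this ⊢
      rw [show (level G e v α).2 = _ from congrArg Prod.snd (level_eq v α)]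
      exact Classical.epsilon_spec this
    by_cases h0 : history G e v α = ∅
    · rw [h0]
      exact exists_isPartChoice_root e ⟨v, hv⟩
    by_cases h1 : ∃ β < α, ∀ γ < α, γ ≤ β
    · obtain ⟨β, hβ, hmax⟩ := h1
      obtain ⟨γ, hγ, hβγ, hj⟩ := exists_setsJoined_level hv ih hβ
      obtain rfl := hβγ.antisymm (hmax γ hγ)
      refine exists_isPartChoice_succ e ⟨β, hβ, rfl⟩ ?_ hj
      rintro _ ⟨δ, hδ, rfl⟩ hle
      rcases (hmax δ hδ).eq_or_lt with rfl | h
      · rfl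
      · exact absurd hle (hss h hβ).not_subset
    · push Not at h1
      refine exists_isPartChoice_limit e (Set.nonempty_iff_ne_empty.2 h0) ?_
        (isComponentOf_level hv).connected ?_
      · rintro _ ⟨β, hβ, rfl⟩
        obtain ⟨γ, hγ, hβγ⟩ := h1 β hβ
        exact ⟨_, ⟨γ, hγ, rfl⟩, hss hβγ hγ⟩
      · rintro _ ⟨β, hβ, rfl⟩
        obtain ⟨γ, hγ, hβγ, hj⟩ := exists_setsJoined_level hv ih hβ
        exact ⟨_, ⟨γ, hγ, rfl⟩, level_subset hβγ, hj⟩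

/-- Strictness comes from the parts being non-empty: each level loses the vertices of its part. -/
theorem level_ssubset_iff (hα : v ∈ (level G e v α).1) :
    (level G e v β).1 ⊂ (level G e v α).1 ↔ α < β := by
  refine ⟨fun h => not_le.1 fun h' => h.not_subset (level_subset h'), fun h => ?_⟩
  obtain ⟨y, hy⟩ := nonempty_of_connected_induce (isPartChoice_level hα).connected
  exact ⟨level_subset h.le, fun h' =>
    (level_subset_diff h (h' ((isPartChoice_level hα).subset hy))).2 hy⟩

theorem level_fst_inj (hα : v ∈ (level G e v α).1) (hβ : v ∈ (level G e v β).1)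
    (h : (level G e v α).1 = (level G e v β).1) : α = β := by
  rcases lt_trichotomy α β with h' | h' | h'
  · exact absurd h.symm ((level_ssubset_iff hα).2 h').ne
  · exact h'
  · exact absurd h ((level_ssubset_iff hβ).2 h').ne

variable (G e)

/-- The nodes of the tree, each given by its pair of sets. -/
@[ext]
structure TreeNode : Type u where
  /-- The set of vertices treated at or above the node, and the set of vertices used up at it. -/
  pair : Set V × Set V
  /-- The pair of sets occurs in the construction. -/
  exists_eq : ∃ v α, level G e v α = pair ∧ v ∈ pair.1

variable {G e}

theorem TreeNode.exists_level (t : TreeNode G e) (hv : v ∈ t.1.1) :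
    ∃ α, level G e v α = t.1 := by
  obtain ⟨_, w, α, rfl, hw⟩ := t
  exact ⟨α, level_congr hv le_rfl⟩

theorem TreeNode.fst_injective : Function.Injective fun t : TreeNode G e => t.1.1 := by
  intro s t (hst : s.1.1 = t.1.1)
  obtain ⟨v, α, hα, hv⟩ := s.2
  obtain ⟨β, hβ⟩ := t.exists_level (hst ▸ hv)
  refine TreeNode.ext ?_
  rw [← hα] at hst hv ⊢
  rw [← hβ] at hst ⊢
  rw [level_fst_inj hv (hst ▸ hv) hst]

instance : PartialOrder (TreeNode G e) :=
  PartialOrder.lift (fun t => OrderDual.toDual t.1.1) TreeNode.fst_injective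

theorem TreeNode.lt_iff {s t : TreeNode G e} : s < t ↔ t.1.1 ⊂ s.1.1 := Iff.rfl

theorem TreeNode.le_iff {s t : TreeNode G e} : s ≤ t ↔ t.1.1 ⊆ s.1.1 := Iff.rfl

/-- This identifies tree predecessors with the recursion's history, so facts about levels transfer
to nodes. -/
theorem TreeNode.image_Iio {t : TreeNode G e} (hv : v ∈ (level G e v α).1)
    (ht : level G e v α = t.1) : TreeNode.pair '' Set.Iio t = history G e v α := by
  ext p
  constructor
  · rintro ⟨s, hs, rfl⟩
    have hs : t.1.1 ⊂ s.1.1 := hs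
    rw [← ht] at hs
    obtain ⟨β, hβ⟩ := s.exists_level (hs.subset hv)
    rw [← hβ] at hs ⊢
    exact ⟨β, (level_ssubset_iff (hs.subset hv)).1 hs, rfl⟩
  · rintro ⟨β, hβ, rfl⟩
    have hvβ := level_subset (le_of_lt hβ) hv
    refine ⟨⟨_, v, β, rfl, hvβ⟩, ?_, rfl⟩
    change t.1.1 ⊂ (level G e v β).1
    rw [← ht]
    exact (level_ssubset_iff hvβ).2 hβ

instance : IsTreeOrder (TreeNode G e) where
  wellOrdered t := by
    obtain ⟨v, α, hα, hv⟩ := t.2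
    have hmem : ∀ s : Set.Iio t, v ∈ s.1.1.1 := fun s => (TreeNode.lt_iff.1 s.2).subset hv
    choose f hf using fun s : Set.Iio t => s.1.exists_level (hmem s)
    have hmem' : ∀ s, v ∈ (level G e v (f s)).1 := fun s => by
      rw [hf]
      exact hmem s
    have hinj : Function.Injective f := fun s s' h => Subtype.ext (TreeNode.ext (by
      rw [← hf, ← hf, h]))
    refine RelEmbedding.isWellOrder (s := ((· < ·) : Ordinal.{u} → Ordinal.{u} → Prop))
      ⟨⟨f, hinj⟩, fun {s s'} => ?_⟩
    change f s < f s' ↔ s'.1.1.1 ⊂ s.1.1.1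
    rw [← hf, ← hf, level_ssubset_iff (hmem' s)]

theorem TreeNode.spec (t : TreeNode G e) :
    IsComponentOf G (remainder (TreeNode.pair '' Set.Iio t)) t.1.1 ∧
      IsPartChoice G e (TreeNode.pair '' Set.Iio t) t.1.1 t.1.2 := by
  obtain ⟨v, α, hα, hv⟩ := t.2
  rw [← hα] at hv
  rw [TreeNode.image_Iio hv hα, ← hα]
  exact ⟨isComponentOf_level hv, isPartChoice_level hv⟩

theorem TreeNode.subset_diff_of_lt {s t : TreeNode G e} (h : s < t) :
    t.1.1 ⊆ s.1.1 \ s.1.2 := fun _ hx =>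
  mem_remainder.1 (t.spec.1.subset hx) _ ⟨s, h, rfl⟩

theorem TreeNode.remainder_empty : remainder (∅ : Set (Set V × Set V)) = Set.univ := by
  simp [remainder]

theorem TreeNode.remainder_Iic (s : TreeNode G e) :
    remainder (TreeNode.pair '' Set.Iic s) = s.1.1 \ s.1.2 := by
  ext x
  rw [mem_remainder, Set.forall_mem_image]
  refine ⟨fun h => h (Set.mem_Iic.2 le_rfl), fun h r hr => ?_⟩
  rcases (Set.mem_Iic.1 hr).eq_or_lt with rfl | hr
  · exact h
  · exact TreeNode.subset_diff_of_lt hr h.1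

theorem TreeNode.remainder_of_noMax {b : Set (TreeNode G e)} (h : ∀ s ∈ b, ∃ s' ∈ b, s < s') :
    remainder (TreeNode.pair '' b) = ⋂ s ∈ b, s.1.1 := by
  ext x
  rw [mem_remainder, Set.forall_mem_image]
  simp only [Set.mem_iInter]
  refine ⟨fun hx s hs => (hx hs).1, fun hx s hs => ?_⟩
  obtain ⟨s', hs', hss'⟩ := h s hs
  exact TreeNode.subset_diff_of_lt hss' (hx s' hs')

theorem TreeNode.existsUnique {b : Set (TreeNode G e)} (hb : IsLowerSet b) {D : Set V}
    (hD : IsComponentOf G (remainder (TreeNode.pair '' b)) D) :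
    ∃! t : TreeNode G e, Set.Iio t = b ∧ t.1.1 = D := by
  refine existsUnique_of_exists_of_unique ?_
    fun s t hs ht => TreeNode.fst_injective (hs.2.trans ht.2.symm)
  obtain ⟨v, hvD⟩ := hD.nonempty
  have hvb : ∀ s ∈ b, v ∈ s.1.1 := fun s hs =>
    (mem_remainder.1 (hD.subset hvD) _ ⟨s, hs, rfl⟩).1
  -- The heights of the nodes of `b`, read along the fixed vertex `v` of `D`; the new node sits at
  -- the least ordinal outside this initial segment.
  let A : Set Ordinal.{u} := {β | ∃ s ∈ b, level G e v β = s.1}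
  have hA : ∀ {β}, β ∈ A → v ∈ (level G e v β).1 := by
    rintro β ⟨s, hs, h⟩
    rw [h]
    exact hvb s hs
  have hAlower : ∀ {γ β}, γ ≤ β → β ∈ A → γ ∈ A := by
    rintro γ β hγ hβ
    have hvγ := level_subset hγ (hA hβ)
    obtain ⟨s, hs, h⟩ := hβ
    refine ⟨⟨_, v, γ, rfl, hvγ⟩, hb ?_ hs, rfl⟩
    change s.1.1 ⊆ (level G e v γ).1
    rw [← h]
    exact level_subset hγ
  -- Levels in `A` are distinct, and the class of all ordinals does not inject into the pairs of
  -- vertex sets.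
  have hne : ∃ α, α ∉ A := by
    by_contra! hall
    exact not_injective_of_ordinal (level G e v) fun γ β h =>
      level_fst_inj (hA (hall γ)) (hA (hall β)) (congrArg Prod.fst h)
  obtain ⟨α, hα, hmin⟩ := WellFounded.has_min (wellFounded_lt (α := Ordinal.{u})) {α | α ∉ A} hne
  have hAα : ∀ {β}, β ∈ A ↔ β < α := by
    refine fun {β} => ⟨fun h => not_le.1 fun h' => hα (hAlower h' h), fun h => ?_⟩
    by_contra h'
    exact hmin β h' h
  have himage : history G e v α = TreeNode.pair '' b := by
    ext p
    constructor
    · rintro ⟨β, hβ, rfl⟩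
      obtain ⟨s, hs, h⟩ := hAα.2 hβ
      exact ⟨s, hs, h.symm⟩
    · rintro ⟨s, hs, rfl⟩
      obtain ⟨β, hβ⟩ := s.exists_level (hvb s hs)
      exact ⟨β, hAα.1 ⟨s, hs, hβ⟩, hβ⟩
  have hv : v ∈ (level G e v α).1 := by
    rw [mem_level_iff, himage]
    exact hD.subset hvD
  refine ⟨⟨_, v, α, rfl, hv⟩, ?_, ?_⟩
  · refine Set.image_injective.2 (fun _ _ => TreeNode.ext) ?_
    rw [TreeNode.image_Iio hv rfl, himage]
  · change (level G e v α).1 = D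
    rw [level_fst, himage]
    exact (hD.eq_componentAt hvD).symm

variable (G e)

/-- The tree constructed from the enumeration `e` of the vertices. -/
noncomputable def partitionTree : PartitionTree G where
  Node := TreeNode G e
  enum := e
  C t := t.1.1
  part t := t.1.2
  lt_iff _ _ := Iff.rfl
  root t ht := by
    have h := t.spec
    rw [ht, Set.image_empty, TreeNode.remainder_empty] at h
    exact ⟨h.1, h.2.root rfl⟩
  root_unique D hD := by
    refine TreeNode.existsUnique isLowerSet_empty ?_
    rwa [Set.image_empty, TreeNode.remainder_empty]
  succ s t hst := by
    have h := t.spec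
    rw [IsTreeOrder.Iio_eq_Iic_iff.2 hst, TreeNode.remainder_Iic] at h
    refine ⟨h.1, h.2.succ s.1 ⟨s, Set.mem_Iic.2 le_rfl, rfl⟩ ?_⟩
    rintro _ ⟨r, hr, rfl⟩
    exact TreeNode.le_iff.1 hr
  succ_unique s D hD := by
    simp_rw [← IsTreeOrder.Iio_eq_Iic_iff]
    refine TreeNode.existsUnique (isLowerSet_Iic s) ?_
    rwa [TreeNode.remainder_Iic]
  limit t ht := by
    obtain ⟨hne, hlim⟩ := IsTreeOrder.isSuccLimit_treeHeight_iff.1 ht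
    have h := t.spec
    rw [TreeNode.remainder_of_noMax (b := Set.Iio t) hlim] at h
    obtain ⟨hj, hcard⟩ := h.2.limit (hne.image _) (by
      rintro _ ⟨s, hs, rfl⟩
      obtain ⟨s', hs', hss'⟩ := hlim s hs
      exact ⟨s'.1, ⟨s', hs', rfl⟩, hss'⟩)
    refine ⟨h.1, h.2.subset, h.2.connected, IsTreeOrder.le_cof_treeHeight fun B hB hcof => ?_,
      fun s hs => ?_⟩
    · refine (hcard _ (Set.image_mono hB) ?_).trans mk_image_le
      rintro _ ⟨s, hs, rfl⟩
      obtain ⟨s', hs', hss'⟩ := hcof s hs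
      exact ⟨s'.1, ⟨s', hs', rfl⟩, hss'⟩
    · obtain ⟨_, ⟨s', hs', rfl⟩, hss', hjoin⟩ := hj s.1 ⟨s, hs, rfl⟩
      exact ⟨s', hs', hss', hjoin⟩
  limit_unique b _ hb _ hlim D hD := by
    refine TreeNode.existsUnique hb ?_
    rwa [TreeNode.remainder_of_noMax hlim]

end BrochetDiestel

theorem nonempty_partitionTree {V : Type u} (G : SimpleGraph V) : Nonempty (PartitionTree G) := by
  have h : Nonempty (V ≃ (#V).ord.ToType) := Cardinal.eq.1 (mk_ord_toType _).symm
  obtain ⟨e⟩ := h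
  exact ⟨BrochetDiestel.partitionTree G (e.trans Ordinal.ToType.mk.symm.toEquiv)⟩

theorem mainTheorem10 (κ : Cardinal.{u}) (hκ : κ.IsRegular) :
    -- the construction of `T_G` can be carried out for every graph `G`
    (∀ (V : Type u) (G : SimpleGraph V), Nonempty (PartitionTree G)) ∧
    -- a `K_κ` minor yields a branch of size at least `κ`, whatever choices were made
    (∀ (V : Type u) (G : SimpleGraph V), IsGraphMinor (completeGraphOn κ) G →
      ∀ T : PartitionTree G, ∃ b : Set T.Node, IsBranch b ∧ κ ≤ #b) ∧
    -- a graph of chromatic number two whose tree has a `κ`-branch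
    (∃ (V : Type u) (G : SimpleGraph V), G.chromaticNumber = 2 ∧
      ∀ T : PartitionTree G, ∃ b : Set T.Node, IsBranchOfLength κ b) ∧
    -- a graph with an independent set of size `κ` whose tree is `κ`
    (∃ (V : Type u) (G : SimpleGraph V), (∃ S : Set V, G.IsIndepSet S ∧ #S = κ) ∧
      ∀ T : PartitionTree G, Nonempty (T.Node ≃o Set.Iio κ.ord)) := by
  obtain ⟨V, G, hχ, hS, hT⟩ := exists_bipartite_partitionTree hκ
  exact ⟨fun V G => nonempty_partitionTree G,
    fun V G hG T => exists_large_branch_of_minor hκ hG T,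
    ⟨V, G, hχ, fun T => (hT T).elim fun f => ⟨Set.univ, isBranchOfLength_univ f⟩⟩,
    ⟨V, G, hS, hT⟩⟩
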